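/- A Boolean circuit is built from unbounded fan-in AND and OR gates and NOT gates; it is monotone if it has no NOT gate. $\mathsf{AC}^0$ is the class of families $f=(f_n)_{n\ge 0}$, $f_n:\{0,1\}^n\to\{0,1\}$, for which there are a constant $k$ and a polynomial $p$ such that every $f_n$ is computed by a circuit of depth at most $k$ with at most $p(n)$ gates (nonuniform). A monotone decision tree on $n$ variables is a binary tree whose internal nodes are labelled by monotone functions $\{0,1\}^n\to\{0,1\}$ (the queries) and whose leaves are labelled by bits; on an input $x$ one walks from the root to a leaf, following at each internal node the edge given by the value of its query at $x$, and outputs the label of the leaf. Its height is the maximum number of internal nodes on a root-to-leaf path. For $d:\mathbb N\to\mathbb N$ let $\mathsf{DT}^{d(n)}(\mathsf{AC}^0)$ be the class of families $f$ for which there are a constant $k$ and a polynomial $p$ such that, for every $n$, $f_n$ is computed by a monotone decision tree of height at most $d(n)$ each of whose queries is computed by a monotone circuit of depth at most $k$ with at most $p(n)$ gates. Theorem. Let $r$ be any real constant. (1) For every $f\in\mathsf{AC}^0$ there is $d:\mathbb N\to\mathbb N$ with $d(n)=O\!\left(\frac{n}{\log^r n}\right)$ and $f\in\mathsf{DT}^{d(n)}(\mathsf{AC}^0)$.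 (2) For every $d:\mathbb N\to\mathbb N$ with $d(n)=\Omega\!\left(\frac{n}{\log^r n}\right)$, every $f\in\mathsf{AC}^0$ is computed by monotone decision trees with monotone $\mathsf{AC}^0$ queries of height at most $d(n)$ for all sufficiently large $n$; that is, $f\in\mathsf{DT}^{d'(n)}(\mathsf{AC}^0)$ for some $d':\mathbb N\to\mathbb N$ with $d'(n)\le d(n)$ for all sufficiently large $n$. -/

import Mathlib

open Filter Asymptotics

namespace BoolCircuit

/-- A gate of unbounded fan-in whose inputs are wires from `V`. The empty conjunction and the
empty disjunction are the Boolean constants. -/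
inductive Gate (V : Type) where
  | not (v : V) : Gate V
  | and (S : Finset V) : Gate V
  | or (S : Finset V) : Gate V

/-- The output of a gate when `w` gives the values carried by the wires. -/
def Gate.eval {V : Type} (w : V → Bool) : Gate V → Bool
  | .not v => !(w v)
  | .and S => decide (∀ v ∈ S, w v = true)
  | .or S => decide (∃ v ∈ S, w v = true)

/-- The level of a gate: one more than the largest level `l v` of an input wire `v`. -/
def Gate.level {V : Type} (l : V → ℕ) : Gate V → ℕ
  | .not v => l v + 1
  | .and S => S.sup l + 1
  | .or S => S.sup l + 1

/-- A gate other than negation. -/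
def Gate.IsMonotone {V : Type} : Gate V → Prop
  | .not _ => False
  | .and _ => True
  | .or _ => True

/-- A Boolean circuit with `n` inputs and `s` gates, its gates listed in a topological order:
each new gate reads inputs and earlier gates, and gates have unbounded fan-out. -/
inductive Circuit (n : ℕ) : ℕ → Type where
  | nil : Circuit n 0
  | snoc {s : ℕ} (C : Circuit n s) (g : Gate (Fin n ⊕ Fin s)) : Circuit n (s + 1)

namespace Circuit

/-- The values of the gates on input `x`. -/
def gateVal {n : ℕ} (x : Fin n → Bool) : {s : ℕ} → Circuit n s → Fin s → Bool
  | _, .nil => Fin.elim0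
  | _, .snoc C g => Fin.snoc (α := fun _ => Bool) (C.gateVal x)
      (g.eval (Sum.elim x (C.gateVal x)))

/-- The value of a wire (an input or a gate) on input `x`. -/
def val {n s : ℕ} (C : Circuit n s) (x : Fin n → Bool) : Fin n ⊕ Fin s → Bool :=
  Sum.elim x (C.gateVal x)

/-- The levels of the gates; inputs have level `0`. -/
def gateLevel {n : ℕ} : {s : ℕ} → Circuit n s → Fin s → ℕ
  | _, .nil => Fin.elim0
  | _, .snoc C g => Fin.snoc (α := fun _ => ℕ) C.gateLevel
      (g.level (Sum.elim (fun _ => 0) C.gateLevel))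

/-- The level of a wire: the number of gates on a longest path ending in it. For the output wire
this is the depth of the circuit. -/
def level {n s : ℕ} (C : Circuit n s) : Fin n ⊕ Fin s → ℕ :=
  Sum.elim (fun _ => 0) C.gateLevel

/-- A monotone circuit: none of its gates is a negation. -/
def IsMonotone {n : ℕ} : {s : ℕ} → Circuit n s → Prop
  | _, .nil => True
  | _, .snoc C g => C.IsMonotone ∧ g.IsMonotone

end Circuit

/-- `f` is computed by a circuit of depth at most `k` with at most `m` gates. -/
def HasCircuit {n : ℕ} (f : (Fin n → Bool) → Bool) (k m : ℕ) : Prop :=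
  ∃ s : ℕ, s ≤ m ∧ ∃ (C : Circuit n s) (o : Fin n ⊕ Fin s),
    C.level o ≤ k ∧ ∀ x, C.val x o = f x

/-- `f` is computed by a monotone circuit of depth at most `k` with at most `m` gates. -/
def HasMonotoneCircuit {n : ℕ} (f : (Fin n → Bool) → Bool) (k m : ℕ) : Prop :=
  ∃ s : ℕ, s ≤ m ∧ ∃ (C : Circuit n s) (o : Fin n ⊕ Fin s),
    C.IsMonotone ∧ C.level o ≤ k ∧ ∀ x, C.val x o = f x

/-- A family of Boolean functions, one for each number `n` of variables. -/
abbrev BoolFamily : Type := (n : ℕ) → (Fin n → Bool) → Bool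

/-- (Nonuniform) AC⁰: constant depth, polynomial size, unbounded fan-in. -/
def AC0 : Set BoolFamily :=
  {f | ∃ (k : ℕ) (p : Polynomial ℕ), ∀ n, HasCircuit (f n) k (p.eval n)}

/-- Monotone decision trees on `n` variables: every internal node is labelled by a monotone
function (its query), the subtree `t₀` is entered on answer `0` and `t₁` on answer `1`. -/
inductive MonotoneDecisionTree (n : ℕ) : Type where
  | leaf (b : Bool) : MonotoneDecisionTree n
  | node (q : (Fin n → Bool) →o Bool) (t₀ t₁ : MonotoneDecisionTree n) : MonotoneDecisionTree n

namespace MonotoneDecisionTree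

/-- The output of the tree on input `x`. -/
def eval {n : ℕ} (x : Fin n → Bool) : MonotoneDecisionTree n → Bool
  | .leaf b => b
  | .node q t₀ t₁ => if q x = true then t₁.eval x else t₀.eval x

/-- The maximum number of internal nodes on a path from the root to a leaf. -/
def height {n : ℕ} : MonotoneDecisionTree n → ℕ
  | .leaf _ => 0
  | .node _ t₀ t₁ => max t₀.height t₁.height + 1

/-- The set of queries at the internal nodes. -/
def queries {n : ℕ} : MonotoneDecisionTree n → Set ((Fin n → Bool) →o Bool)
  | .leaf _ => ∅
  | .node q t₀ t₁ => {q} ∪ (t₀.queries ∪ t₁.queries)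

end MonotoneDecisionTree

/-- The families computed by monotone decision trees of height at most `d n` on `n` variables
whose queries have monotone AC⁰ circuits. As the trees form a family indexed by `n`, the depth and
the polynomial bounding the sizes are common to all queries of all the trees. -/
def MDTAC0 (d : ℕ → ℕ) : Set BoolFamily :=
  {f | ∃ (k : ℕ) (p : Polynomial ℕ), ∀ n, ∃ T : MonotoneDecisionTree n,
    (∀ x, T.eval x = f n x) ∧ T.height ≤ d n ∧
      ∀ q ∈ T.queries, HasMonotoneCircuit q k (p.eval n)}

end BoolCircuit

/-! Negation of a variable is monotone once a Hamming weight is known: if `x` has `w` ones on a set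
`S` containing `i`, then `x i` is false exactly when `S` without `i` still has at least `w` ones
(`threshold_erase_eq_not`). So cut the variables into blocks of size `b = A ^ R`, with `A` about the
square root of `log n`, and find the weight of each block by binary search with threshold queries.
On the inputs with these weights, De Morgan's laws push the negations of the given circuit down to
the variables, and a single monotone query finishes (`exists_monotone_on`).

Thresholds on a block have monotone circuits of constant depth and polynomial size
(`hasMonotoneCircuit_threshold`): split the set into `A` parts, guess the weight of each part, and
recurse `R` times. There are at most `(b + 1) ^ A ≤ 2 ^ (R * A ^ 2)` guesses, polynomially many
because `A ^ 2 = O(log n)`.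

A search costs `R * A` queries, so the height is about `R * n / A ^ (R - 1)`. As `R` is a free
constant, the height can be made `o(n / log ^ r n)` (`exists_treeHeight_isLittleO`), which gives
both claims. -/

namespace BoolCircuit

/-! ### Wires, monotonicity and juxtaposition of circuits -/

/-- Renaming the wires of a gate. -/
def Gate.map {V W : Type} (e : V ↪ W) : Gate V → Gate W
  | .not v => .not (e v)
  | .and S => .and (S.map e)
  | .or S => .or (S.map e)

theorem Gate.eval_map {V W : Type} (e : V ↪ W) (w : W → Bool) (g : Gate V) :
    (g.map e).eval w = g.eval (w ∘ e) := by
  cases g <;> simp [Gate.map, Gate.eval]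

theorem Gate.level_map {V W : Type} (e : V ↪ W) (l : W → ℕ) (g : Gate V) :
    (g.map e).level l = g.level (l ∘ e) := by
  cases g <;> simp [Gate.map, Gate.level, Finset.sup_map]

theorem Gate.IsMonotone.map {V W : Type} (e : V ↪ W) {g : Gate V} (h : g.IsMonotone) :
    (g.map e).IsMonotone := by
  cases g <;> simp_all [Gate.map, Gate.IsMonotone]

theorem Gate.IsMonotone.eval_mono {V : Type} {g : Gate V} (hg : g.IsMonotone)
    {w w' : V → Bool} (h : w ≤ w') : g.eval w ≤ g.eval w' := by
  have h' : ∀ v, w v = true → w' v = true := fun v =>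
    Bool.le_iff_imp.1 (h v)
  rw [Bool.le_iff_imp]
  cases g with
  | not v => exact hg.elim
  | and S => simpa [Gate.eval] using fun H v hv => h' v (H v hv)
  | or S => simpa [Gate.eval] using fun v hv H => ⟨v, hv, h' v H⟩

namespace Circuit

variable {n : ℕ}

/-- The inclusion of the wires of a circuit in those of its extension by one gate. -/
def wireCastSucc (n s : ℕ) : Fin n ⊕ Fin s ↪ Fin n ⊕ Fin (s + 1) :=
  (Function.Embedding.refl _).sumMap Fin.castSuccEmb

/-- The inclusion of the wires of the second of two juxtaposed circuits. -/
def wireNatAdd (n s t : ℕ) : Fin n ⊕ Fin t ↪ Fin n ⊕ Fin (s + t) :=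
  (Function.Embedding.refl _).sumMap (Fin.natAddEmb s)

theorem val_snoc_comp {s : ℕ} (C : Circuit n s) (g : Gate (Fin n ⊕ Fin s)) (x : Fin n → Bool) :
    (C.snoc g).val x ∘ wireCastSucc n s = C.val x := by
  ext (i | j) <;> simp [val, wireCastSucc, gateVal]

theorem level_snoc_comp {s : ℕ} (C : Circuit n s) (g : Gate (Fin n ⊕ Fin s)) :
    (C.snoc g).level ∘ wireCastSucc n s = C.level := by
  ext (i | j) <;> simp [level, wireCastSucc, gateLevel]

theorem val_snoc_last {s : ℕ} (C : Circuit n s) (g : Gate (Fin n ⊕ Fin s)) (x : Fin n → Bool) :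
    (C.snoc g).val x (.inr (Fin.last s)) = g.eval (C.val x) := by
  simp [val, gateVal]

theorem level_snoc_last {s : ℕ} (C : Circuit n s) (g : Gate (Fin n ⊕ Fin s)) :
    (C.snoc g).level (.inr (Fin.last s)) = g.level C.level := by
  simp [level, gateLevel]

/-- Every gate wire carries the output of a gate that reads wires of the same circuit. -/
theorem exists_gate {s : ℕ} (C : Circuit n s) (j : Fin s) :
    ∃ g : Gate (Fin n ⊕ Fin s), (∀ x, C.val x (.inr j) = g.eval (C.val x)) ∧
      C.level (.inr j) = g.level C.level := by
  induction C with
  | nil => exact j.elim0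
  | @snoc s C g ih =>
    induction j using Fin.lastCases with
    | last =>
      refine ⟨g.map (wireCastSucc n s), fun x => ?_, ?_⟩
      · rw [Gate.eval_map, val_snoc_comp, val_snoc_last]
      · rw [Gate.level_map, level_snoc_comp, level_snoc_last]
    | cast j =>
      obtain ⟨g', h, h'⟩ := ih j
      refine ⟨g'.map (wireCastSucc n s), fun x => ?_, ?_⟩
      · rw [Gate.eval_map, val_snoc_comp, ← h, ← val_snoc_comp C g]
        rfl
      · rw [Gate.level_map, level_snoc_comp, ← h', ← level_snoc_comp C g]
        rfl

theorem IsMonotone.val_mono {s : ℕ} {C : Circuit n s} (hC : C.IsMonotone)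
    {x y : Fin n → Bool} (h : x ≤ y) : C.val x ≤ C.val y := by
  induction C with
  | nil => exact fun | .inl i => h i | .inr j => j.elim0
  | @snoc s C g ih =>
    rintro (i | j)
    · exact h i
    · induction j using Fin.lastCases with
      | last =>
        rw [val_snoc_last, val_snoc_last]
        exact hC.2.eval_mono (ih hC.1)
      | cast j =>
        have := ih hC.1 (.inr j)
        rw [← val_snoc_comp C g, ← val_snoc_comp C g] at this
        exact this

/-- Juxtaposition of two circuits on the same inputs. -/
def append {s : ℕ} (C : Circuit n s) : {t : ℕ} → Circuit n t → Circuit n (s + t)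
  | _, .nil => C
  | t + 1, .snoc D g => .snoc (C.append D) (g.map (wireNatAdd n s t))

theorem append_spec {s : ℕ} (C : Circuit n s) {t : ℕ} (D : Circuit n t) :
    (∀ x, (C.append D).val x ∘ wireNatAdd n s t = D.val x) ∧
      (C.append D).level ∘ wireNatAdd n s t = D.level := by
  induction D with
  | nil => constructor <;> intros <;> ext (i | j) <;> first | rfl | exact j.elim0
  | @snoc t D g ih =>
    constructor
    · intro x
      ext (i | j)
      · rfl
      · induction j using Fin.lastCases with
        | last =>
          rw [val_snoc_last, ← ih.1 x, ← Gate.eval_map]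
          exact val_snoc_last (C.append D) _ x
        | cast j =>
          have h1 := congrFun (val_snoc_comp D g x) (.inr j)
          have h2 := congrFun (ih.1 x) (.inr j)
          have h3 := congrFun (val_snoc_comp (C.append D) (g.map (wireNatAdd n s t)) x)
            (wireNatAdd n s t (.inr j))
          exact h3.trans (h2.trans h1.symm)
    · ext (i | j)
      · rfl
      · induction j using Fin.lastCases with
        | last =>
          rw [level_snoc_last, ← ih.2, ← Gate.level_map]
          exact level_snoc_last (C.append D) _
        | cast j =>
          have h1 := congrFun (level_snoc_comp D g) (.inr j)
          have h2 := congrFun ih.2 (.inr j)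
          have h3 := congrFun (level_snoc_comp (C.append D) (g.map (wireNatAdd n s t)))
            (wireNatAdd n s t (.inr j))
          exact h3.trans (h2.trans h1.symm)

theorem exists_append_wire {s : ℕ} (C : Circuit n s) {t : ℕ} (D : Circuit n t)
    (o : Fin n ⊕ Fin s) :
    ∃ o', (∀ x, (C.append D).val x o' = C.val x o) ∧ (C.append D).level o' = C.level o := by
  induction D with
  | nil => exact ⟨o, fun _ => rfl, rfl⟩
  | @snoc t D g ih =>
    obtain ⟨o', h, h'⟩ := ih
    refine ⟨wireCastSucc n (s + t) o', fun x => ?_, ?_⟩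
    · rw [← h, ← val_snoc_comp (C.append D) (g.map (wireNatAdd n s t))]
      rfl
    · rw [← h', ← level_snoc_comp (C.append D) (g.map (wireNatAdd n s t))]
      rfl

theorem IsMonotone.append {s : ℕ} {C : Circuit n s} (hC : C.IsMonotone) {t : ℕ}
    {D : Circuit n t} (hD : D.IsMonotone) : (C.append D).IsMonotone := by
  induction D with
  | nil => exact hC
  | snoc D g ih => exact ⟨ih hD.1, hD.2.map _⟩

end Circuit

/-! ### Closure of small monotone circuits under AND and OR -/

section Combinators

variable {n : ℕ}

theorem HasMonotoneCircuit.mono {f : (Fin n → Bool) → Bool} {k m k' m' : ℕ}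
    (h : HasMonotoneCircuit f k m) (hk : k ≤ k') (hm : m ≤ m') : HasMonotoneCircuit f k' m' := by
  obtain ⟨s, hs, C, o, hC, hl, hv⟩ := h
  exact ⟨s, hs.trans hm, C, o, hC, hl.trans hk, hv⟩

theorem HasMonotoneCircuit.monotone {f : (Fin n → Bool) → Bool} {k m : ℕ}
    (h : HasMonotoneCircuit f k m) : Monotone f := by
  obtain ⟨s, hs, C, o, hC, hl, hv⟩ := h
  intro x y hxy
  rw [← hv, ← hv]
  exact hC.val_mono hxy o

theorem hasMonotoneCircuit_input (i : Fin n) : HasMonotoneCircuit (fun x => x i) 0 0 :=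
  ⟨0, le_rfl, .nil, .inl i, trivial, le_rfl, fun _ => rfl⟩

/-- Finitely many functions with monotone circuits are computed by one monotone circuit. -/
theorem exists_common_circuit {ι : Type*} (S : Finset ι) (g : ι → (Fin n → Bool) → Bool)
    {k m : ℕ} (h : ∀ i ∈ S, HasMonotoneCircuit (g i) k m) :
    ∃ s ≤ S.card * m, ∃ C : Circuit n s, C.IsMonotone ∧
      ∀ i ∈ S, ∃ o, C.level o ≤ k ∧ ∀ x, C.val x o = g i x := by
  classical
  induction S using Finset.induction_on with
  | empty => exact ⟨0, by simp, .nil, trivial, by simp⟩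
  | insert a S ha ih =>
    obtain ⟨s, hs, C, hC, H⟩ := ih fun i hi => h i (Finset.mem_insert_of_mem hi)
    obtain ⟨t, ht, D, o, hD, hl, hv⟩ := h a (Finset.mem_insert_self _ _)
    refine ⟨s + t, ?_, C.append D, hC.append hD, ?_⟩
    · rw [Finset.card_insert_of_notMem ha, add_mul, one_mul]
      exact add_le_add hs ht
    · intro i hi
      rcases Finset.mem_insert.1 hi with rfl | hi
      · have hspec := C.append_spec D
        refine ⟨Circuit.wireNatAdd n s t o, ?_, fun x => ?_⟩
        · exact (congrFun hspec.2 o).trans_le hl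
        · exact (congrFun (hspec.1 x) o).trans (hv x)
      · obtain ⟨o, hl, hv⟩ := H i hi
        obtain ⟨o', h1, h2⟩ := C.exists_append_wire D o
        exact ⟨o', h2.trans_le hl, fun x => (h1 x).trans (hv x)⟩

theorem HasMonotoneCircuit.and {ι : Type*} {S : Finset ι} {g : ι → (Fin n → Bool) → Bool}
    {k m : ℕ} (h : ∀ i ∈ S, HasMonotoneCircuit (g i) k m) {f : (Fin n → Bool) → Bool}
    (hf : ∀ x, f x = true ↔ ∀ i ∈ S, g i x = true) :
    HasMonotoneCircuit f (k + 1) (S.card * m + 1) := by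
  classical
  obtain ⟨s, hs, C, hC, H⟩ := exists_common_circuit S g h
  -- The new gate reads every shallow wire that carries some `g i`; redundant wires do no harm, and
  -- no choice of wires is needed.
  refine ⟨s + 1, by lia, C.snoc (.and (Finset.univ.filter fun o =>
    C.level o ≤ k ∧ ∃ i ∈ S, ∀ x, C.val x o = g i x)), .inr (Fin.last s), ?_, ?_, ?_⟩
  · exact ⟨hC, trivial⟩
  · rw [Circuit.level_snoc_last]
    exact Nat.succ_le_succ (Finset.sup_le fun o ho => (Finset.mem_filter.1 ho).2.1)
  · intro x
    rw [Circuit.val_snoc_last, Bool.eq_iff_iff, hf]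
    simp only [Gate.eval, decide_eq_true_eq, Finset.mem_filter, Finset.mem_univ, true_and]
    constructor
    · intro A i hi
      obtain ⟨o, hl, hv⟩ := H i hi
      rw [← hv]
      exact A o ⟨hl, i, hi, hv⟩
    · rintro A o ⟨-, i, hi, hv⟩
      rw [hv]
      exact A i hi

theorem HasMonotoneCircuit.or {ι : Type*} {S : Finset ι} {g : ι → (Fin n → Bool) → Bool}
    {k m : ℕ} (h : ∀ i ∈ S, HasMonotoneCircuit (g i) k m) {f : (Fin n → Bool) → Bool}
    (hf : ∀ x, f x = true ↔ ∃ i ∈ S, g i x = true) :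
    HasMonotoneCircuit f (k + 1) (S.card * m + 1) := by
  classical
  obtain ⟨s, hs, C, hC, H⟩ := exists_common_circuit S g h
  refine ⟨s + 1, by lia, C.snoc (.or (Finset.univ.filter fun o =>
    C.level o ≤ k ∧ ∃ i ∈ S, ∀ x, C.val x o = g i x)), .inr (Fin.last s), ?_, ?_, ?_⟩
  · exact ⟨hC, trivial⟩
  · rw [Circuit.level_snoc_last]
    exact Nat.succ_le_succ (Finset.sup_le fun o ho => (Finset.mem_filter.1 ho).2.1)
  · intro x
    rw [Circuit.val_snoc_last, Bool.eq_iff_iff, hf]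
    simp only [Gate.eval, decide_eq_true_eq, Finset.mem_filter, Finset.mem_univ, true_and]
    constructor
    · rintro ⟨o, ⟨-, i, hi, hv⟩, ho⟩
      exact ⟨i, hi, hv x ▸ ho⟩
    · rintro ⟨i, hi, hx⟩
      obtain ⟨o, hl, hv⟩ := H i hi
      exact ⟨o, ⟨hl, i, hi, hv⟩, (hv x).trans hx⟩

theorem hasMonotoneCircuit_const (b : Bool) :
    HasMonotoneCircuit (fun _ : Fin n → Bool => b) 1 1 := by
  cases b
  · simpa using HasMonotoneCircuit.or (n := n) (S := (∅ : Finset Unit)) (g := fun _ _ => false)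
      (k := 0) (m := 0) (by simp) (f := fun _ => false) (by simp)
  · simpa using HasMonotoneCircuit.and (n := n) (S := (∅ : Finset Unit)) (g := fun _ _ => false)
      (k := 0) (m := 0) (by simp) (f := fun _ => true) (by simp)

end Combinators

/-! ### Threshold functions of polylogarithmically many variables -/

section Threshold

variable {n : ℕ}

/-- The number of ones of `x` on the set `S` of positions. -/
def weight (S : Finset (Fin n)) (x : Fin n → Bool) : ℕ :=
  (S.filter fun i => x i = true).card

/-- The threshold function: are there at least `w` ones of `x` on `S`? -/
def threshold (S : Finset (Fin n)) (w : ℕ) (x : Fin n → Bool) : Bool :=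
  decide (w ≤ weight S x)

/-- Greedy colouring: each colour takes `m` elements, or all that remain. With `m = A ^ j` it splits
a set for the threshold recursion. -/
theorem exists_small_fibers {α : Type*} (S : Finset α) {A m : ℕ} (h : S.card ≤ A * m) :
    ∃ P : α → ℕ, (∀ i ∈ S, P i < A) ∧ ∀ c, (S.filter fun i => P i = c).card ≤ m := by
  classical
  induction A generalizing S with
  | zero =>
    have : S = ∅ := by simpa using h
    exact ⟨fun _ => 0, by simp [this], by simp [this]⟩
  | succ A ih =>
    obtain ⟨T, hTS, hT⟩ := Finset.exists_subset_card_eq (s := S) (n := min m S.card)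
      (min_le_right _ _)
    obtain ⟨P, hP, hc⟩ := ih (S \ T) (by
      rw [Finset.card_sdiff_of_subset hTS, hT]
      rw [add_mul] at h
      lia)
    refine ⟨fun i => if i ∈ T then A else P i, fun i hi => ?_, fun c => ?_⟩
    · by_cases hiT : i ∈ T
      · simp [hiT]
      · have := hP i (by simp [hi, hiT])
        simp only [hiT, if_false]
        lia
    · rcases eq_or_ne c A with rfl | hcA
      · refine (Finset.card_le_card (t := T) fun i hi => ?_).trans (hT ▸ min_le_left _ _)
        rw [Finset.mem_filter] at hi
        by_contra hiT
        have := hP i (by simp [hi.1, hiT])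
        simp only [hiT, if_false] at hi
        lia
      · refine (Finset.card_le_card fun i hi => ?_).trans (hc c)
        rw [Finset.mem_filter] at hi ⊢
        by_cases hiT : i ∈ T
        · simp only [hiT, if_true] at hi
          exact absurd hi.2.symm hcA
        · simp only [hiT, if_false] at hi
          simp [hi, hiT]

theorem weight_eq_sum_fibers (S : Finset (Fin n)) {A : ℕ} {P : Fin n → ℕ}
    (hP : ∀ i ∈ S, P i < A) (x : Fin n → Bool) :
    weight S x = ∑ c : Fin A, weight (S.filter fun i => P i = c) x := by
  rw [Fin.sum_univ_eq_sum_range (fun c => weight (S.filter fun i => P i = c) x)]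
  unfold weight
  rw [Finset.card_eq_sum_card_fiberwise (f := P) (t := Finset.range A)]
  · refine Finset.sum_congr rfl fun c _ => ?_
    rw [Finset.filter_comm]
  · intro i hi
    simp only [Finset.coe_filter, Set.mem_ofPred_eq] at hi
    simpa using hP i hi.1

theorem weight_le_card (S : Finset (Fin n)) (x : Fin n → Bool) : weight S x ≤ S.card :=
  Finset.card_filter_le _ _

/-- Thresholds of `A ^ j` variables, by recursion on `j`: the weight is split among `A` parts. -/
theorem hasMonotoneCircuit_threshold {A B : ℕ} (hA : 0 < A) (j : ℕ) (hB : A ^ j ≤ B)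
    (S : Finset (Fin n)) (hS : S.card ≤ A ^ j) (w : ℕ) :
    HasMonotoneCircuit (threshold S w) (2 * j + 1) (((B + 1) ^ A * (A + 1) + 1) ^ j) := by
  -- `B` stays fixed and bounds the part weights at every level, so each level multiplies the size
  -- by the same factor.
  induction j generalizing S w with
  | zero =>
    rw [pow_zero] at hS ⊢
    rcases Nat.eq_zero_or_pos w with rfl | hw
    · convert hasMonotoneCircuit_const (n := n) true using 1
      ext x
      simp [threshold]
    · rcases Nat.lt_or_ge S.card w with hlt | hge
      · convert hasMonotoneCircuit_const (n := n) false using 1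
        ext x
        simpa [threshold] using (weight_le_card S x).trans_lt hlt
      · obtain ⟨i, rfl⟩ := Finset.card_eq_one.1 (show S.card = 1 by lia)
        obtain rfl : w = 1 := by lia
        convert (hasMonotoneCircuit_input i).mono (Nat.zero_le 1) (Nat.zero_le 1) using 1
        ext x
        cases hx : x i <;> simp [threshold, weight, Finset.filter_singleton, hx]
  | succ j ih =>
    obtain ⟨P, hP, hc⟩ := exists_small_fibers S (A := A) (m := A ^ j) (by rwa [← pow_succ'])
    have hB' : A ^ j ≤ B := (Nat.pow_le_pow_right hA j.le_succ).trans hB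
    set M := ((B + 1) ^ A * (A + 1) + 1) ^ j with hM
    have hM1 : 1 ≤ M := Nat.one_le_pow _ _ (Nat.succ_pos _)
    -- The weight is at least `w` iff some tuple `v` of sum at least `w` is dominated by the part
    -- weights: an OR over tuples of an AND over parts.
    let V : Finset (Fin A → Fin (B + 1)) := Finset.univ.filter fun v => w ≤ ∑ c, (v c : ℕ)
    let g : (Fin A → Fin (B + 1)) → (Fin n → Bool) → Bool := fun v x =>
      decide (∀ c : Fin A, threshold (S.filter fun i => P i = c) (v c) x = true)
    have hg : ∀ v ∈ V, HasMonotoneCircuit (g v) (2 * j + 1 + 1) (A * M + 1) := fun v _ => by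
      simpa using HasMonotoneCircuit.and (S := (Finset.univ : Finset (Fin A)))
        (g := fun c => threshold (S.filter fun i => P i = c) (v c))
        (fun c _ => ih hB' _ (hc c) (v c)) (f := g v) (by simp [g])
    refine (HasMonotoneCircuit.or hg (f := threshold S w) fun x => ?_).mono (by lia) ?_
    · simp only [threshold, V, g, decide_eq_true_eq, Finset.mem_filter, Finset.mem_univ,
        true_and, weight_eq_sum_fibers S hP x]
      constructor
      · intro h
        refine ⟨fun c => ⟨weight (S.filter fun i => P i = c) x, ?_⟩, h, fun c => le_rfl⟩
        have := (weight_le_card (S.filter fun i => P i = c) x).trans (hc c)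
        lia
      · rintro ⟨v, hv, h⟩
        exact hv.trans (Finset.sum_le_sum fun c _ => h c)
    · have hV : V.card ≤ (B + 1) ^ A := by
        simpa using Finset.card_le_univ V
      calc V.card * (A * M + 1) + 1 ≤ (B + 1) ^ A * (A * M + M) + M := by gcongr
        _ = ((B + 1) ^ A * (A + 1) + 1) ^ (j + 1) := by rw [pow_succ, ← hM]; ring

/-- Once the weight on `S` is known, negation of a variable in `S` is a threshold function. -/
theorem threshold_erase_eq_not {S : Finset (Fin n)} {i : Fin n} (hi : i ∈ S) (x : Fin n → Bool) :
    threshold (S.erase i) (weight S x) x = !x i := by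
  have h : weight (S.erase i) x = weight S x - if x i = true then 1 else 0 := by
    unfold weight
    rw [Finset.filter_erase]
    split_ifs with h
    · exact Finset.card_erase_of_mem (by simp [hi, h])
    · rw [Finset.erase_eq_of_notMem (by simp [h]), Nat.sub_zero]
  have hpos : x i = true → 0 < weight S x := fun h =>
    Finset.card_pos.2 ⟨i, by simp [hi, h]⟩
  cases hx : x i <;> simp_all [threshold]

end Threshold

/-! ### Removing negations where the negated variables are monotone -/

section Slice

variable {n : ℕ}

/-- On a set of inputs where the negated variables agree with monotone functions, a circuit can
be replaced by a monotone circuit, and so can its negation. -/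
theorem exists_monotone_on {s : ℕ} (C : Circuit n s) (X : Set (Fin n → Bool))
    (h : Fin n → (Fin n → Bool) → Bool) {D M : ℕ} (hM : 0 < M)
    (hc : ∀ i, HasMonotoneCircuit (h i) D M) (hX : ∀ i, ∀ x ∈ X, h i x = !x i) (k : ℕ)
    (o : Fin n ⊕ Fin s) (ho : C.level o ≤ k) (b : Bool) :
    ∃ g, HasMonotoneCircuit g (D + k) ((n + s + 1) ^ k * M) ∧
      ∀ x ∈ X, g x = (b ^^ C.val x o) := by
  -- Both signs `b` are carried along: a NOT gate flips `b`, and for `b = true` AND and OR are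
  -- exchanged.
  induction k generalizing o b with
  | zero =>
    rcases o with i | j
    · cases b
      · exact ⟨_, (hasMonotoneCircuit_input i).mono (Nat.zero_le _) (Nat.zero_le _),
          fun x _ => by simp [Circuit.val]⟩
      · exact ⟨_, (hc i).mono le_rfl (by simp), fun x hx => by simp [Circuit.val, hX i x hx]⟩
    · obtain ⟨g, -, hg⟩ := C.exists_gate j
      rw [hg] at ho
      cases g <;> simp [Gate.level] at ho
  | succ k ih =>
    rcases Nat.lt_or_ge k (C.level o) with hlt | hle
    swap
    · obtain ⟨g, h1, h2⟩ := ih o hle b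
      exact ⟨g, h1.mono (by lia)
        (Nat.mul_le_mul_right _ (Nat.pow_le_pow_right (Nat.succ_pos _) k.le_succ)), h2⟩
    rcases o with i | j
    · simp [Circuit.level] at hlt
    choose! G hG1 hG2 using ih
    obtain ⟨g, hv, hl⟩ := C.exists_gate j
    rw [hl] at ho
    -- Subcircuits are copied for each input of a gate, hence a factor `n + s + 1` per level.
    have hsize : ∀ S : Finset (Fin n ⊕ Fin s),
        S.card * ((n + s + 1) ^ k * M) + 1 ≤ (n + s + 1) ^ (k + 1) * M := fun S => by
      have hS : S.card ≤ n + s := by simpa using Finset.card_le_univ S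
      have hpos : 0 < (n + s + 1) ^ k * M := by positivity
      calc _ ≤ (n + s) * ((n + s + 1) ^ k * M) + (n + s + 1) ^ k * M := by gcongr; exact hpos
        _ = _ := by ring
    cases g with
    | not v =>
      have hv' : C.level v ≤ k := Nat.le_of_succ_le_succ ho
      refine ⟨G v (!b), (hG1 v hv' _).mono (by lia)
        (Nat.mul_le_mul_right _ (Nat.pow_le_pow_right (Nat.succ_pos _) k.le_succ)), ?_⟩
      intro x hx
      rw [hG2 v hv' _ x hx, hv]
      simp [Gate.eval]
    | and S =>
      have hS : ∀ v ∈ S, C.level v ≤ k := Finset.sup_le_iff.1 (Nat.le_of_succ_le_succ ho)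
      cases b
      · refine ⟨fun x => decide (∀ v ∈ S, G v false x = true), (HasMonotoneCircuit.and
          (fun v hv => hG1 v (hS v hv) false) (by simp)).mono (by lia) (hsize S), fun x hx => ?_⟩
        rw [hv, Bool.false_xor, Bool.eq_iff_iff]
        simp only [Gate.eval, decide_eq_true_eq]
        exact forall₂_congr fun v hv => by rw [hG2 v (hS v hv) _ x hx, Bool.false_xor]
      · refine ⟨fun x => decide (∃ v ∈ S, G v true x = true), (HasMonotoneCircuit.or
          (fun v hv => hG1 v (hS v hv) true) (by simp)).mono (by lia) (hsize S), fun x hx => ?_⟩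
        rw [hv, Bool.true_xor, Bool.eq_iff_iff]
        simp only [Gate.eval, decide_eq_true_eq, Bool.not_eq_true', decide_eq_false_iff_not,
          not_forall, exists_prop]
        exact exists_congr fun v => and_congr_right fun hv => by
          rw [hG2 v (hS v hv) _ x hx]; simp
    | or S =>
      have hS : ∀ v ∈ S, C.level v ≤ k := Finset.sup_le_iff.1 (Nat.le_of_succ_le_succ ho)
      cases b
      · refine ⟨fun x => decide (∃ v ∈ S, G v false x = true), (HasMonotoneCircuit.or
          (fun v hv => hG1 v (hS v hv) false) (by simp)).mono (by lia) (hsize S), fun x hx => ?_⟩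
        rw [hv, Bool.false_xor, Bool.eq_iff_iff]
        simp only [Gate.eval, decide_eq_true_eq]
        exact exists_congr fun v => and_congr_right fun hv => by
          rw [hG2 v (hS v hv) _ x hx, Bool.false_xor]
      · refine ⟨fun x => decide (∀ v ∈ S, G v true x = true), (HasMonotoneCircuit.and
          (fun v hv => hG1 v (hS v hv) true) (by simp)).mono (by lia) (hsize S), fun x hx => ?_⟩
        rw [hv, Bool.true_xor, Bool.eq_iff_iff]
        simp only [Gate.eval, decide_eq_true_eq, Bool.not_eq_true', decide_eq_false_iff_not,
          not_exists, not_and]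
        exact forall₂_congr fun v hv => by rw [hG2 v (hS v hv) _ x hx]; simp

end Slice

/-! ### Decision trees on a restricted set of inputs -/

section Trees

variable {n : ℕ}

/-- `f` agrees on `X` with a monotone decision tree of height at most `h` whose queries have
monotone circuits of depth at most `k` with at most `m` gates. -/
def HasTreeOn (f : (Fin n → Bool) → Bool) (k m : ℕ) (X : Set (Fin n → Bool)) (h : ℕ) : Prop :=
  ∃ T : MonotoneDecisionTree n, (∀ x ∈ X, T.eval x = f x) ∧ T.height ≤ h ∧
    ∀ q ∈ T.queries, HasMonotoneCircuit q k m

variable {f : (Fin n → Bool) → Bool} {k m : ℕ}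

theorem HasTreeOn.mono {X Y : Set (Fin n → Bool)} {h h' : ℕ} (H : HasTreeOn f k m X h)
    (hY : Y ⊆ X) (hh : h ≤ h') : HasTreeOn f k m Y h' := by
  obtain ⟨T, h1, h2, h3⟩ := H
  exact ⟨T, fun x hx => h1 x (hY hx), h2.trans hh, h3⟩

theorem HasTreeOn.node {q : (Fin n → Bool) → Bool} (hq : HasMonotoneCircuit q k m)
    {X : Set (Fin n → Bool)} {h : ℕ} (H₀ : HasTreeOn f k m (X ∩ {x | q x = false}) h)
    (H₁ : HasTreeOn f k m (X ∩ {x | q x = true}) h) : HasTreeOn f k m X (h + 1) := by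
  obtain ⟨T₀, a₀, b₀, c₀⟩ := H₀
  obtain ⟨T₁, a₁, b₁, c₁⟩ := H₁
  refine ⟨.node ⟨q, hq.monotone⟩ T₀ T₁, fun x hx => ?_, ?_, ?_⟩
  · simp only [MonotoneDecisionTree.eval, OrderHom.coe_mk]
    split_ifs with h
    · exact a₁ x ⟨hx, h⟩
    · exact a₀ x ⟨hx, by simpa using h⟩
  · exact Nat.succ_le_succ (max_le b₀ b₁)
  · rintro q' (rfl | h | h)
    · exact hq
    · exact c₀ q' h
    · exact c₁ q' h

theorem hasTreeOn_one {q : (Fin n → Bool) → Bool} (hq : HasMonotoneCircuit q k m)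
    {X : Set (Fin n → Bool)} (h : ∀ x ∈ X, q x = f x) : HasTreeOn f k m X 1 :=
  HasTreeOn.node hq
    ⟨.leaf false, fun x hx => by rw [← h x hx.1]; exact hx.2.symm, le_rfl, fun _ h => h.elim⟩
    ⟨.leaf true, fun x hx => by rw [← h x hx.1]; exact hx.2.symm, le_rfl, fun _ h => h.elim⟩

/-- Binary search for the weight on `S`. -/
theorem HasTreeOn.search {S : Finset (Fin n)}
    (hS : ∀ w, HasMonotoneCircuit (threshold S w) k m) {X : Set (Fin n → Bool)} {h : ℕ}
    (H : ∀ w, HasTreeOn f k m (X ∩ {x | weight S x = w}) h) (c lo : ℕ) :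
    HasTreeOn f k m (X ∩ {x | lo ≤ weight S x ∧ weight S x < lo + 2 ^ c}) (h + c) := by
  induction c generalizing lo with
  | zero =>
    refine (H lo).mono (fun x hx => ⟨hx.1, ?_⟩) le_rfl
    have := hx.2
    simp only [Set.mem_ofPred_eq, pow_zero] at this ⊢
    lia
  | succ c ih =>
    refine HasTreeOn.node (hS (lo + 2 ^ c)) ((ih lo).mono ?_ le_rfl)
      ((ih (lo + 2 ^ c)).mono ?_ le_rfl)
    all_goals
      rintro x ⟨⟨h1, h2⟩, h3⟩
      refine ⟨h1, ?_⟩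
      simp only [threshold, Set.mem_ofPred_eq, decide_eq_false_iff_not, decide_eq_true_eq,
        pow_succ] at h2 h3 ⊢
      lia

/-- Successive binary searches, `c` queries each. The set `X` records the weights already found, so
the final tree may depend on all of them. -/
theorem HasTreeOn.searchAll {S : ℕ → Finset (Fin n)} {c : ℕ} (hc : ∀ j, (S j).card < 2 ^ c)
    (hS : ∀ j w, HasMonotoneCircuit (threshold (S j) w) k m) {h : ℕ} (t : ℕ)
    {X : Set (Fin n → Bool)}
    (H : ∀ w : ℕ → ℕ, HasTreeOn f k m (X ∩ {x | ∀ j < t, weight (S j) x = w j}) h) :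
    HasTreeOn f k m X (h + t * c) := by
  induction t generalizing X with
  | zero => exact (H 0).mono (fun x hx => ⟨hx, by simp⟩) (by simp)
  | succ t ih =>
    refine (HasTreeOn.search (hS t) (fun w => ih (X := X ∩ {x | weight (S t) x = w})
      fun v => (H (Function.update v t w)).mono ?_ le_rfl) c 0).mono ?_ (by lia)
    · rintro x ⟨⟨h1, h2⟩, h3⟩
      refine ⟨h1, fun j hj => ?_⟩
      rcases Nat.lt_succ_iff_lt_or_eq.1 hj with hj | rfl
      · rw [Function.update_of_ne hj.ne]
        exact h3 j hj
      · rw [Function.update_self]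
        exact h2
    · intro x hx
      exact ⟨hx, Nat.zero_le _, by simpa using (weight_le_card (S t) x).trans_lt (hc t)⟩

end Trees

/-! ### The tree for a circuit, its query size and its height -/

section Upper

/-- The fan-in of the threshold recursion, about the square root of `log n`. -/
def fanIn (n : ℕ) : ℕ := Nat.sqrt (Nat.log 2 (n + 1)) + 1

theorem card_block_le (n b j : ℕ) (hb : 0 < b) :
    (Finset.univ.filter fun i : Fin n => i.val / b = j).card ≤ b := by
  refine (Finset.card_le_card_of_injOn (t := Finset.range b) (fun i => i.val % b)
    (fun i _ => by simpa using Nat.mod_lt _ hb) fun i hi i' hi' h => ?_).trans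
    (Finset.card_range b).le
  have h1 : i.val / b = j := by simpa using hi
  have h2 : i'.val / b = j := by simpa using hi'
  ext
  rw [← Nat.div_add_mod i.val b, ← Nat.div_add_mod i'.val b, h1, h2]
  exact congrArg _ h

theorem HasCircuit.hasTreeOn {n k m : ℕ} {f : (Fin n → Bool) → Bool} (hf : HasCircuit f k m)
    {A R : ℕ} (hA : 0 < A) (hR : 0 < R) :
    HasTreeOn f (2 * R + 1 + k) ((n + m + 1) ^ k * (((A ^ R + 1) ^ A * (A + 1) + 1) ^ R))
      Set.univ ((n / A ^ R + 1) * (R * A) + 1) := by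
  obtain ⟨s, hs, C, o, hl, hv⟩ := hf
  set M := ((A ^ R + 1) ^ A * (A + 1) + 1) ^ R with hM
  have hM0 : 0 < M := by positivity
  set b := A ^ R with hb
  have hb0 : 0 < b := by positivity
  let S : ℕ → Finset (Fin n) := fun j => Finset.univ.filter fun i : Fin n => i.val / b = j
  have hS : ∀ j, (S j).card ≤ b := fun j => card_block_le n b j hb0
  have hthr : ∀ T : Finset (Fin n), T.card ≤ b → ∀ w,
      HasMonotoneCircuit (threshold T w) (2 * R + 1) M := fun T hT w =>
    hasMonotoneCircuit_threshold hA R le_rfl T hT w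
  have hc : ∀ j, (S j).card < 2 ^ (R * A) := fun j => (hS j).trans_lt <| by
    rw [hb, mul_comm, pow_mul]
    exact Nat.pow_lt_pow_left Nat.lt_two_pow_self hR.ne'
  -- The block indices `i / b` are at most `n / b`, so `n / b + 1` searches suffice; `h := 1` is the
  -- final query.
  refine (HasTreeOn.searchAll hc (h := 1) (fun j w => (hthr _ (hS j) w).mono (by lia)
    (Nat.le_mul_of_pos_left _ (by positivity))) (n / b + 1) fun w => ?_).mono le_rfl (by lia)
  have hmem : ∀ i : Fin n, i ∈ S (i.val / b) := fun i => by simp [S]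
  obtain ⟨g, hg, hgX⟩ := exists_monotone_on C
    (Set.univ ∩ {x | ∀ j < n / b + 1, weight (S j) x = w j})
    (fun i => threshold ((S (i.val / b)).erase i) (w (i.val / b))) hM0
    (fun i => hthr _ ((Finset.card_erase_le).trans (hS _)) _)
    (fun i x hx => by
      rw [← hx.2 (i.val / b) (Nat.lt_succ_of_le (Nat.div_le_div_right i.2.le))]
      exact threshold_erase_eq_not (hmem i) x) k o hl false
  refine hasTreeOn_one (hg.mono le_rfl ?_) fun x hx => ?_
  · gcongr
  · rw [hgX x hx, hv, Bool.false_xor]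

/-- The reason for the square root in `fanIn`: the exponent `R * fanIn n ^ 2` of 2 is only
logarithmic in `n`. -/
theorem fanIn_tuples_le (n R : ℕ) (hR : 0 < R) :
    (fanIn n ^ R + 1) ^ fanIn n ≤ 4 ^ R * (n + 1) ^ (2 * R) := by
  set a := Nat.sqrt (Nat.log 2 (n + 1)) with ha
  have h1 : fanIn n ^ R + 1 ≤ 2 ^ (R * fanIn n) := by
    rw [mul_comm, pow_mul]
    exact Nat.pow_lt_pow_left Nat.lt_two_pow_self hR.ne'
  have h2 : fanIn n * fanIn n ≤ 2 * Nat.log 2 (n + 1) + 2 := by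
    have : a * a ≤ Nat.log 2 (n + 1) := Nat.sqrt_le _
    have h3 : a ≤ a * a := Nat.le_mul_self a
    unfold fanIn
    rw [← ha]
    rcases a with _ | _ | a
    · lia
    · lia
    · nlinarith
  calc (fanIn n ^ R + 1) ^ fanIn n ≤ (2 ^ (R * fanIn n)) ^ fanIn n := Nat.pow_le_pow_left h1 _
    _ = 2 ^ (R * (fanIn n * fanIn n)) := by rw [← pow_mul, mul_assoc]
    _ ≤ 2 ^ (R * (2 * Nat.log 2 (n + 1) + 2)) :=
        Nat.pow_le_pow_right two_pos (Nat.mul_le_mul_left _ h2)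
    _ = 4 ^ R * (2 ^ Nat.log 2 (n + 1)) ^ (2 * R) := by
        rw [show (4 : ℕ) = 2 ^ 2 by rfl, ← pow_mul, ← pow_mul, ← pow_add]
        congr 1
        ring
    _ ≤ 4 ^ R * (n + 1) ^ (2 * R) := by
        gcongr
        exact Nat.pow_log_le_self 2 (Nat.succ_ne_zero n)

theorem fanIn_le (n : ℕ) : fanIn n ≤ n + 2 := by
  have h1 := Nat.sqrt_le_self (Nat.log 2 (n + 1))
  have h2 := Nat.log_le_self 2 (n + 1)
  unfold fanIn
  lia

/-- The height of the trees when the blocks have `fanIn n ^ R` variables. -/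
def treeHeight (R n : ℕ) : ℕ := (n / fanIn n ^ R + 1) * (R * fanIn n) + 1

theorem mem_MDTAC0_treeHeight {f : BoolFamily} (hf : f ∈ AC0) {R : ℕ} (hR : 0 < R) :
    f ∈ MDTAC0 (treeHeight R) := by
  obtain ⟨k, p, hp⟩ := hf
  refine ⟨2 * R + 1 + k, (.X + p + 1) ^ k *
    ((4 ^ R * (.X + 1) ^ (2 * R)) * (.X + 3) + 1) ^ R, fun n => ?_⟩
  obtain ⟨T, h1, h2, h3⟩ := (hp n).hasTreeOn (A := fanIn n) (Nat.succ_pos _) hR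
  refine ⟨T, fun x => h1 x trivial, h2, fun q hq => (h3 q hq).mono le_rfl ?_⟩
  have h4 := fanIn_tuples_le n R hR
  have h5 : fanIn n + 1 ≤ n + 3 := Nat.succ_le_succ (fanIn_le n)
  simp only [Polynomial.eval_mul, Polynomial.eval_pow, Polynomial.eval_add, Polynomial.eval_X,
    Polynomial.eval_one, Polynomial.eval_ofNat]
  gcongr

/-! ### Asymptotics of the height -/

theorem log_le_fanIn_sq (n : ℕ) : Real.log n ≤ (fanIn n : ℝ) ^ 2 := by
  rcases Nat.eq_zero_or_pos n with rfl | hn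
  · simp
  have h1 : n < 2 ^ (Nat.log 2 (n + 1) + 1) :=
    n.lt_succ_self.trans (Nat.lt_pow_succ_log_self one_lt_two (n + 1))
  have h2 : Nat.log 2 (n + 1) + 1 ≤ fanIn n ^ 2 := by
    have := Nat.lt_succ_sqrt (Nat.log 2 (n + 1))
    rw [sq]
    exact this
  have h3 : n ≤ 2 ^ (fanIn n ^ 2) := h1.le.trans (Nat.pow_le_pow_right two_pos h2)
  calc Real.log n ≤ Real.log ((2 : ℝ) ^ (fanIn n ^ 2)) :=
        Real.log_le_log (by exact_mod_cast hn) (by exact_mod_cast h3)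
    _ = (fanIn n : ℝ) ^ 2 * Real.log 2 := by rw [Real.log_pow]; push_cast; ring
    _ ≤ (fanIn n : ℝ) ^ 2 := mul_le_of_le_one_right (sq_nonneg _) (by
        linarith [Real.log_two_lt_d9])

theorem fanIn_le_log {n : ℕ} (hn : 3 ≤ n) : (fanIn n : ℝ) ≤ 5 * Real.log n := by
  have hn' : (3 : ℝ) ≤ n := by exact_mod_cast hn
  have h0 : 1 ≤ Real.log n := by
    rw [Real.le_log_iff_exp_le (by linarith)]
    linarith [Real.exp_one_lt_d9]
  have h1 : (fanIn n : ℝ) ≤ Nat.log 2 (n + 1) + 1 := by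
    exact_mod_cast Nat.succ_le_succ (Nat.sqrt_le_self (Nat.log 2 (n + 1)))
  have h2 : (Nat.log 2 (n + 1) : ℝ) * Real.log 2 ≤ 2 * Real.log n := by
    have h3 : ((2 ^ Nat.log 2 (n + 1) : ℕ) : ℝ) ≤ (n : ℝ) ^ 2 := by
      have : ((2 ^ Nat.log 2 (n + 1) : ℕ) : ℝ) ≤ ((n + 1 : ℕ) : ℝ) := by
        exact_mod_cast Nat.pow_log_le_self 2 (Nat.succ_ne_zero n)
      push_cast at this ⊢
      nlinarith
    have h4 := Real.log_le_log (by positivity) h3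
    rw [Real.log_pow] at h4
    push_cast at h4
    rwa [Real.log_pow] at h4
  nlinarith [Real.log_two_gt_d9]

theorem treeHeight_isBigO {r : ℝ} (hr : 0 ≤ r) {R : ℕ} (hR : 2 * r + 1 ≤ R) :
    (fun n : ℕ => (treeHeight R n : ℝ)) =O[atTop] fun n : ℕ => (n : ℝ) / Real.log n ^ r := by
  have hsmall : ∀ᶠ n : ℕ in atTop, Real.log n ^ (r + 1) ≤ n := by
    have := ((isLittleO_log_rpow_rpow_atTop (r + 1) one_pos).comp_tendsto
      tendsto_natCast_atTop_atTop).bound one_pos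
    filter_upwards [this, eventually_ge_atTop 1] with n hn hn1
    simpa [abs_of_nonneg (Real.rpow_nonneg (Real.log_natCast_nonneg n) (r + 1))] using hn
  -- `R` comes from the `n / b` searches, `5 * R` from the extra block through `fanIn_le_log`, and
  -- `1` from the final query.
  refine IsBigO.of_bound (6 * R + 1) ?_
  filter_upwards [hsmall, eventually_ge_atTop 3] with n hn hn3
  have hn' : (3 : ℝ) ≤ n := by exact_mod_cast hn3
  have hL : 1 ≤ Real.log n := by
    rw [Real.le_log_iff_exp_le (by linarith)]
    linarith [Real.exp_one_lt_d9]
  set L := Real.log n with hLdef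
  set A := (fanIn n : ℝ) with hA
  have hA1 : 1 ≤ A := by
    rw [hA]
    exact_mod_cast Nat.succ_pos _
  have hLr : 0 < L ^ r := by positivity
  -- Of the exponent `2 * r + 1`, the part `2 * r` pays for `L ^ r`, since `L ≤ A ^ 2`, and `1` for
  -- the factor `A` of the binary search.
  have hpow : L ^ r * A ≤ A ^ R := by
    have h1 : L ^ r ≤ A ^ (2 * r) := by
      rw [Real.rpow_mul (by linarith), Real.rpow_two]
      exact Real.rpow_le_rpow (by linarith) (log_le_fanIn_sq n) hr
    calc L ^ r * A ≤ A ^ (2 * r) * A := by gcongr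
      _ = A ^ (2 * r + 1) := by rw [Real.rpow_add_one (by linarith)]
      _ ≤ A ^ (R : ℝ) := Real.rpow_le_rpow_of_exponent_le hA1 hR
      _ = A ^ R := Real.rpow_natCast _ _
  have hlow : L ≤ n / L ^ r := by
    rw [le_div_iff₀ hLr, mul_comm, ← Real.rpow_add_one (by linarith)]
    exact hn
  have hmain : ((n / fanIn n ^ R : ℕ) : ℝ) * A ≤ n / L ^ r := by
    have h1 : ((n / fanIn n ^ R : ℕ) : ℝ) ≤ n / A ^ R := by
      simpa using Nat.cast_div_le (α := ℝ) (m := n) (n := fanIn n ^ R)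
    rw [le_div_iff₀ hLr]
    calc _ ≤ n / A ^ R * A * L ^ r := by gcongr
      _ = n / A ^ R * (L ^ r * A) := by ring
      _ ≤ n / A ^ R * A ^ R := by gcongr
      _ = n := by field_simp
  have hA5 : A ≤ 5 * (n / L ^ r) := (fanIn_le_log hn3).trans (by linarith)
  rw [Real.norm_of_nonneg (Nat.cast_nonneg _), Real.norm_of_nonneg (by positivity)]
  have hcast : (treeHeight R n : ℝ) =
      R * (((n / fanIn n ^ R : ℕ) : ℝ) * A) + R * A + 1 := by
    unfold treeHeight
    push_cast
    ring
  rw [hcast]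
  calc _ ≤ R * (n / L ^ r) + R * (5 * (n / L ^ r)) + n / L ^ r := by
        gcongr
        exact hL.trans hlow
    _ = _ := by ring

theorem isLittleO_div_log_rpow {r r' : ℝ} (h : r < r') :
    (fun n : ℕ => (n : ℝ) / Real.log n ^ r') =o[atTop] fun n : ℕ => (n : ℝ) / Real.log n ^ r := by
  have hlog : Tendsto (fun n : ℕ => Real.log n) atTop atTop :=
    Real.tendsto_log_atTop.comp tendsto_natCast_atTop_atTop
  have h0 : (fun n : ℕ => Real.log n ^ (-(r' - r))) =o[atTop] fun _ => (1 : ℝ) :=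
    (isLittleO_one_iff ℝ).2 ((tendsto_rpow_neg_atTop (sub_pos.2 h)).comp hlog)
  refine ((isBigO_refl (fun n : ℕ => (n : ℝ) / Real.log n ^ r) atTop).mul_isLittleO
    h0).congr' ?_ (by simp)
  filter_upwards [hlog.eventually_gt_atTop 0] with n hn
  rw [Real.rpow_neg hn.le, Real.rpow_sub hn]
  have := Real.rpow_pos_of_pos hn r
  field_simp

theorem exists_treeHeight_isLittleO (r : ℝ) : ∃ R : ℕ, 0 < R ∧
    (fun n : ℕ => (treeHeight R n : ℝ)) =o[atTop] fun n : ℕ => (n : ℝ) / Real.log n ^ r := by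
  have hr' : 0 ≤ max r 0 + 1 := by positivity
  -- The exponent `max r 0 + 1` is nonnegative and strictly above `r`; the spare power of `log n`
  -- turns big O into little o.
  refine ⟨⌈2 * (max r 0 + 1) + 1⌉₊, Nat.ceil_pos.2 (by linarith), ?_⟩
  exact (treeHeight_isBigO hr' (Nat.le_ceil _)).trans_isLittleO
    (isLittleO_div_log_rpow (by linarith [le_max_left r 0]))

end Upper

end BoolCircuit

theorem mainTheorem6 (r : ℝ) :
    (∀ f ∈ BoolCircuit.AC0, ∃ d : ℕ → ℕ,
      (fun n : ℕ => (d n : ℝ)) =O[atTop] (fun n : ℕ => (n : ℝ) / Real.log n ^ r) ∧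
        f ∈ BoolCircuit.MDTAC0 d) ∧
    (∀ d : ℕ → ℕ,
      (fun n : ℕ => (n : ℝ) / Real.log n ^ r) =O[atTop] (fun n : ℕ => (d n : ℝ)) →
        ∀ f ∈ BoolCircuit.AC0, ∃ d' : ℕ → ℕ,
          (∀ᶠ n in atTop, d' n ≤ d n) ∧ f ∈ BoolCircuit.MDTAC0 d') := by
  obtain ⟨R, hR, ho⟩ := BoolCircuit.exists_treeHeight_isLittleO r
  refine ⟨fun f hf => ⟨_, ho.isBigO, BoolCircuit.mem_MDTAC0_treeHeight hf hR⟩,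
    fun d hd f hf => ⟨_, ?_, BoolCircuit.mem_MDTAC0_treeHeight hf hR⟩⟩
  -- Little o absorbs the unknown constant in `hd`, so the bound holds with constant 1.
  filter_upwards [(ho.trans_isBigO hd).bound one_pos] with n hn
  simpa using hn
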